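/- Conventions. A Cauchy name of a real $x$ is a sequence $(q_n)_{n\in\mathbb N}$ of rationals converging to $x$ with $|q_k-q_n|\le 2^{-n}$ for all $k\ge n$. A real is computable if it has a computable Cauchy name; $\mathbb{R}_c$ is the set of computable reals, with the metric of $\mathbb{R}$. A real is $\Delta^0_3$ if it has a $\emptyset''$-computable Cauchy name. A function $f:\mathbb{R}_c\to\mathbb{R}_c$ is Markov computable if there is a partial computable function that sends every index of a computable Cauchy name of any $x\in\mathbb{R}_c$ to an index of a computable Cauchy name of $f(x)$. A modulus of uniform continuity of $f$ is a function $\theta$ from the positive rationals to the positive rationals such that, for every rational $\epsilon>0$ and all $x,y\in\mathbb{R}_c$, $|x-y|\le\theta(\epsilon)$ implies $|f(x)-f(y)|\le\epsilon$. The maximal continuous extension $R[f]$ of $f$ is the partial function on $\mathbb{R}$ with $R[f](r)=f(r)$ for $r\in\mathbb{R}_c$ and, for $r\notin\mathbb{R}_c$, $R[f](r)=\lim_{x\to r,\,x\in\mathbb{R}_c}f(x)$ if this limit exists in $\mathbb{R}$, and $R[f](r)$ undefined otherwise. Theorem (Demuth, Kryl, Kučera). Let $f:\mathbb{R}_c\to\mathbb{R}_c$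 be a Markov computable function that is constant on $\mathbb{R}_c\cap(-\infty,0]$ and constant on $\mathbb{R}_c\cap[1,\infty)$. Then the following are equivalent: 1. $f$ is uniformly continuous on $\mathbb{R}_c$; 2. $f$ is $\emptyset'$-uniformly continuous, i.e. $f$ has a $\emptyset'$-computable modulus of uniform continuity; 3. $R[f]$ is defined at all $\Delta^0_3$ reals; 4. $R[f]$ is defined at all reals. -/

import Mathlib

namespace MarkovAnalysis

/-! ### Oracle machines, the Turing jump and the sets `∅⁽ᵏ⁾` -/

/-- The characteristic function of a set of natural numbers, as an oracle. -/
noncomputable def charFun (A : Set ℕ) : ℕ →. ℕ := fun n =>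
  open Classical in Part.some (if n ∈ A then 1 else 0)

/-- Programs with one oracle: the codes `Nat.Partrec.Code` for partial recursive functions,
with an additional instruction that queries the oracle. -/
inductive OracleCode : Type
  | zero : OracleCode
  | succ : OracleCode
  | left : OracleCode
  | right : OracleCode
  | oracle : OracleCode
  | pair : OracleCode → OracleCode → OracleCode
  | comp : OracleCode → OracleCode → OracleCode
  | prec : OracleCode → OracleCode → OracleCode
  | rfind : OracleCode → OracleCode

namespace OracleCode

/-- The partial function computed by a program with oracle `A`. -/
noncomputable def eval (A : Set ℕ) : OracleCode → ℕ →. ℕ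
  | zero => fun _ => 0
  | succ => fun n => Part.some (Nat.succ n)
  | left => fun n => Part.some (Nat.unpair n).1
  | right => fun n => Part.some (Nat.unpair n).2
  | oracle => charFun A
  | pair c d => fun n => Nat.pair <$> eval A c n <*> eval A d n
  | comp c d => fun n => eval A d n >>= eval A c
  | prec c d => fun p =>
      let (a, n) := Nat.unpair p
      n.rec (eval A c a) fun y IH => do
        let i ← IH
        eval A d (Nat.pair a (Nat.pair y i))
  | rfind c => fun a => Nat.rfind fun n => (fun m => m = 0) <$> eval A c (Nat.pair a n)

/-- The number (index) of a program. -/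
def index : OracleCode → ℕ
  | zero => 0
  | succ => 1
  | left => 2
  | right => 3
  | oracle => 4
  | pair c d => 4 * Nat.pair (index c) (index d) + 5
  | comp c d => 4 * Nat.pair (index c) (index d) + 6
  | prec c d => 4 * Nat.pair (index c) (index d) + 7
  | rfind c => 4 * index c + 8

/-- Every natural number is the index of exactly one program. -/
theorem index_bijective : Function.Bijective index := by
  constructor
  · intro c
    induction c with
    | zero | succ | left | right | oracle =>
      intro d h
      cases d <;> simp only [index] at h <;> first | rfl | omega
    | pair a b iha ihb | comp a b iha ihb | prec a b iha ihb =>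
      intro d h
      cases d <;> simp only [index] at h <;> first | omega | skip
      rename_i a' b'
      have hp : Nat.pair (index a) (index b) = Nat.pair (index a') (index b') := by omega
      obtain ⟨h1, h2⟩ := Nat.pair_eq_pair.1 hp
      rw [iha h1, ihb h2]
    | rfind a iha =>
      intro d h
      cases d <;> simp only [index] at h <;> first | omega | skip
      rename_i a'
      have hp : index a = index a' := by omega
      rw [iha hp]
  · intro n
    induction n using Nat.strong_induction_on with
    | _ n ih =>
      by_cases h5 : n < 5
      · interval_cases n
        exacts [⟨zero, rfl⟩, ⟨succ, rfl⟩, ⟨left, rfl⟩, ⟨right, rfl⟩, ⟨oracle, rfl⟩]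
      · obtain ⟨m, r, hr, rfl⟩ : ∃ m r, r < 4 ∧ n = 4 * m + r + 5 :=
          ⟨(n - 5) / 4, (n - 5) % 4, by omega, by omega⟩
        have h1 := Nat.unpair_left_le m
        have h2 := Nat.unpair_right_le m
        obtain ⟨c, hc⟩ := ih m.unpair.1 (by omega)
        obtain ⟨d, hd⟩ := ih m.unpair.2 (by omega)
        obtain ⟨e, he⟩ := ih m (by omega)
        interval_cases r
        · exact ⟨pair c d, by simp [index, hc, hd]⟩
        · exact ⟨comp c d, by simp [index, hc, hd]⟩
        · exact ⟨prec c d, by simp [index, hc, hd]⟩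
        · exact ⟨rfind e, by simp [index, he]⟩

/-- The programs with oracle `A` compute exactly the partial functions recursive in `A`. -/
theorem exists_eval_iff (A : Set ℕ) (f : ℕ →. ℕ) :
    (∃ c : OracleCode, c.eval A = f) ↔ Nat.RecursiveIn {charFun A} f := by
  constructor
  · rintro ⟨c, rfl⟩
    induction c with
    | zero => exact .zero
    | succ => exact .succ
    | left => exact .left
    | right => exact .right
    | oracle => exact .oracle _ rfl
    | pair _ _ h1 h2 => exact .pair h1 h2
    | comp _ _ h1 h2 => exact .comp h1 h2
    | prec _ _ h1 h2 => exact .prec h1 h2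
    | rfind _ h => exact .rfind h
  · intro h
    induction h with
    | zero => exact ⟨zero, rfl⟩
    | succ => exact ⟨succ, rfl⟩
    | left => exact ⟨left, rfl⟩
    | right => exact ⟨right, rfl⟩
    | oracle g hg => rw [Set.mem_singleton_iff.1 hg]; exact ⟨oracle, rfl⟩
    | pair _ _ h1 h2 =>
      obtain ⟨c, rfl⟩ := h1
      obtain ⟨d, rfl⟩ := h2
      exact ⟨pair c d, rfl⟩
    | comp _ _ h1 h2 =>
      obtain ⟨c, rfl⟩ := h1
      obtain ⟨d, rfl⟩ := h2
      exact ⟨comp c d, rfl⟩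
    | prec _ _ h1 h2 =>
      obtain ⟨c, rfl⟩ := h1
      obtain ⟨d, rfl⟩ := h2
      exact ⟨prec c d, rfl⟩
    | rfind _ h =>
      obtain ⟨c, rfl⟩ := h
      exact ⟨rfind c, rfl⟩

end OracleCode

/-- The Turing jump `A'`: the set of all `e` such that the `e`-th program with oracle `A` halts
on input `e`. -/
def jump (A : Set ℕ) : Set ℕ :=
  {e | ∃ c : OracleCode, c.index = e ∧ (c.eval A e).Dom}

/-- The `k`-th Turing jump `∅⁽ᵏ⁾` of the empty set. -/
def emptyJump (k : ℕ) : Set ℕ := jump^[k] ∅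

/-! ### Cauchy names and computable reals -/

/-- The rational number with code `m = ⟨⟨a, b⟩, c⟩`, namely `(a - b) / (c + 1)`. -/
def ratOfCode (m : ℕ) : ℚ :=
  ((m.unpair.1.unpair.1 : ℚ) - (m.unpair.1.unpair.2 : ℚ)) / ((m.unpair.2 : ℚ) + 1)

/-- Every rational number has a code. -/
theorem ratOfCode_surjective : Function.Surjective ratOfCode := by
  intro q
  refine ⟨Nat.pair (Nat.pair q.num.toNat (-q.num).toNat) (q.den - 1), ?_⟩
  have hd : ((q.den - 1 : ℕ) : ℚ) + 1 = q.den := by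
    have := q.den_pos
    exact_mod_cast Nat.sub_add_cancel this
  have hn : ((q.num.toNat : ℚ) - ((-q.num).toNat : ℚ)) = q.num := by
    exact_mod_cast Int.toNat_sub_toNat_neg q.num
  simp only [ratOfCode, Nat.unpair_pair]
  rw [hd, hn, Rat.num_div_den]

/-- A Cauchy name of the real `x`: a sequence of rationals converging to `x` with
`|q k - q n| ≤ 2⁻ⁿ` for all `k ≥ n`. -/
def IsCauchyName (q : ℕ → ℚ) (x : ℝ) : Prop :=
  (∀ n k, n ≤ k → |q k - q n| ≤ (2 : ℚ)⁻¹ ^ n) ∧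
    Filter.Tendsto (fun n => (q n : ℝ)) Filter.atTop (nhds x)

/-- A real is computable in `A` if it has a Cauchy name that is computable in `A`. -/
def IsComputableRealIn (A : Set ℕ) (x : ℝ) : Prop :=
  ∃ g : ℕ → ℕ, ComputableIn {charFun A} g ∧ IsCauchyName (fun n => ratOfCode (g n)) x

/-- A real is computable if it has a computable Cauchy name. -/
def IsComputableReal (x : ℝ) : Prop :=
  ∃ g : ℕ → ℕ, Computable g ∧ IsCauchyName (fun n => ratOfCode (g n)) x

/-- The computable reals `ℝ_c`, with the metric induced from `ℝ`. -/
abbrev Rc : Type := {x : ℝ // IsComputableReal x}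

/-- A real is `Δ⁰₃` if it is computable in `∅''`. -/
def IsDelta03Real (x : ℝ) : Prop := IsComputableRealIn (emptyJump 2) x

/-- The program `c` is an index of a computable Cauchy name of `x`: it halts on every input and
the rationals that it outputs form a Cauchy name of `x`. -/
def IsNameIndex (c : Nat.Partrec.Code) (x : ℝ) : Prop :=
  ∃ g : ℕ → ℕ, (∀ n, c.eval n = Part.some (g n)) ∧ IsCauchyName (fun n => ratOfCode (g n)) x

/-! ### Markov computable functions, moduli of continuity and the maximal extension -/

/-- `f` is Markov computable: some partial recursive `F` maps every index of a computable Cauchy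
name of a computable real `x` to an index of a computable Cauchy name of `f x`. -/
def IsMarkovComputable (f : Rc → Rc) : Prop :=
  ∃ F : Nat.Partrec.Code →. Nat.Partrec.Code, Partrec F ∧
    ∀ (x : Rc) (c : Nat.Partrec.Code), IsNameIndex c x → ∃ d ∈ F c, IsNameIndex d (f x)

/-- `θ` is a modulus of uniform continuity of `f`. -/
def IsModulus (f : Rc → Rc) (θ : {q : ℚ // 0 < q} → {q : ℚ // 0 < q}) : Prop :=
  ∀ (ε : {q : ℚ // 0 < q}) (x y : Rc),
    |(x : ℝ) - (y : ℝ)| ≤ ((θ ε : ℚ) : ℝ) → |(f x : ℝ) - (f y : ℝ)| ≤ ((ε : ℚ) : ℝ)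

/-- `θ` is computable in `A` as a function on the positive rationals: from a code of `ε` one
can compute with oracle `A` a code of `θ ε`. -/
def IsRatFunComputableIn (A : Set ℕ) (θ : {q : ℚ // 0 < q} → {q : ℚ // 0 < q}) : Prop :=
  ∃ t : ℕ → ℕ, ComputableIn {charFun A} t ∧
    ∀ (m : ℕ) (hm : 0 < ratOfCode m), ratOfCode (t m) = θ ⟨ratOfCode m, hm⟩

/-- `f` is `A`-uniformly continuous: it has a modulus of uniform continuity computable in `A`. -/
def IsUniformlyContinuousIn (A : Set ℕ) (f : Rc → Rc) : Prop :=
  ∃ θ : {q : ℚ // 0 < q} → {q : ℚ // 0 < q}, IsRatFunComputableIn A θ ∧ IsModulus f θ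

/-- The maximal continuous extension `R[f]`, a partial function on `ℝ`: it agrees with `f` on the
computable reals, and at a noncomputable `r` its value is the limit of `f x` as the computable
real `x` tends to `r`, if that limit exists, and is undefined otherwise. -/
noncomputable def maxExt (f : Rc → Rc) : ℝ →. ℝ := fun r =>
  open Classical in
  if h : IsComputableReal r then Part.some (f ⟨r, h⟩ : ℝ)
  else
    { Dom := ∃ l : ℝ, Filter.Tendsto (fun x : Rc => (f x : ℝ))
        (Filter.comap (fun x : Rc => (x : ℝ)) (nhds r)) (nhds l)
      get := fun hl => hl.choose }

end MarkovAnalysis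

/-!
A Markov computable function `f` on the computable reals is continuous
(`IsMarkovComputable.continuous`). By the recursion theorem there is a program that imitates a name
of `x` until the realizer of `f`, run on this very program, commits itself to an approximation of
`f x`, and that then switches to a nearby rational with a very different image, if there is one.
Correctness of the realizer excludes such rationals, so `f` varies little on the rationals near `x`;
density then gives continuity at `x`.

By continuity, whether `f` oscillates by more than `ε` at scale `δ` below `b` (`Oscillates`) is
witnessed by rationals, hence is a recursively enumerable condition (`rePred_oscillates`) and
decidable in `∅'`. As `f` is constant on `[1, ∞)`, uniform continuity only depends on `b = 2`.
If `f` is uniformly continuous, searching for the first scale `2⁻ⁿ` without oscillation gives a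
modulus computable in `∅'`, and completeness of `ℝ` gives all the limits that define the maximal
extension.

If `f` is not uniformly continuous, then for some `ε` it oscillates at every scale below `2`. Let
`r` be the infimum of all `b` such that it oscillates at every scale below `b` (`firstBadPoint`);
it exists since `f` is constant on `(-∞, 0]`. Oscillation at every scale is decidable in `∅''`, so
the least multiple of `2⁻ⁿ` below which `f` oscillates at every scale can be found, and `r` is a
`Δ⁰₃` real (`isDelta03Real_firstBadPoint`). But `f` has no limit at `r`
(`not_tendsto_firstBadPoint`); in particular `r` is not computable, by continuity, so that the
maximal extension is undefined there.
-/

namespace MarkovAnalysis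

/-! ### Rational arithmetic on codes -/

/-- A code of the sum of two coded rationals. -/
def addCode (m n : ℕ) : ℕ :=
  Nat.pair
    (Nat.pair
      (m.unpair.1.unpair.1 * (n.unpair.2 + 1) + n.unpair.1.unpair.1 * (m.unpair.2 + 1))
      (m.unpair.1.unpair.2 * (n.unpair.2 + 1) + n.unpair.1.unpair.2 * (m.unpair.2 + 1)))
    ((m.unpair.2 + 1) * (n.unpair.2 + 1) - 1)

/-- A code of the dyadic rational `k / 2 ^ n`. -/
def dyadicCode (k n : ℕ) : ℕ :=
  Nat.pair (Nat.pair k 0) (2 ^ n - 1)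

theorem ratOfCode_addCode (m n : ℕ) : ratOfCode (addCode m n) = ratOfCode m + ratOfCode n := by
  simp only [ratOfCode, addCode, Nat.unpair_pair]
  rw [Nat.cast_sub (Nat.mul_pos (Nat.succ_pos _) (Nat.succ_pos _))]
  push_cast
  field_simp
  ring

theorem ratOfCode_dyadicCode (k n : ℕ) : ratOfCode (dyadicCode k n) = k * (2 : ℚ)⁻¹ ^ n := by
  simp only [ratOfCode, dyadicCode, Nat.unpair_pair]
  rw [Nat.cast_sub Nat.one_le_two_pow]
  push_cast
  simp [div_eq_mul_inv]

section Primrec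

open _root_.Primrec

theorem primrec₂_addCode : Primrec₂ addCode := by
  have num : Primrec fun m : ℕ => m.unpair.1.unpair.1 := fst.comp (unpair.comp (fst.comp unpair))
  have neg : Primrec fun m : ℕ => m.unpair.1.unpair.2 := snd.comp (unpair.comp (fst.comp unpair))
  have den : Primrec fun m : ℕ => m.unpair.2 + 1 := succ.comp (snd.comp unpair)
  have cross {u : ℕ → ℕ} (hu : Primrec u) :
      Primrec fun p : ℕ × ℕ => u p.1 * (p.2.unpair.2 + 1) + u p.2 * (p.1.unpair.2 + 1) :=
    nat_add.comp (nat_mul.comp (hu.comp fst) (den.comp snd))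
      (nat_mul.comp (hu.comp snd) (den.comp fst))
  have top := Primrec₂.natPair.comp (cross num) (cross neg)
  have bot : Primrec fun p : ℕ × ℕ => (p.1.unpair.2 + 1) * (p.2.unpair.2 + 1) - 1 :=
    nat_sub.comp (nat_mul.comp (den.comp fst) (den.comp snd)) (const 1)
  exact (Primrec₂.natPair.comp top bot).of_eq fun p => by rw [addCode]

theorem primrec₂_dyadicCode : Primrec₂ dyadicCode :=
  Primrec₂.natPair.comp (Primrec₂.natPair.comp fst (const 0))
    (nat_sub.comp ((Primrec₂.unpaired'.1 Nat.Primrec.pow).comp (const 2) snd) (const 1))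

theorem primrecRel_ratOfCode_lt : PrimrecRel fun m n => ratOfCode m < ratOfCode n := by
  have num : Primrec fun m : ℕ => m.unpair.1.unpair.1 := fst.comp (unpair.comp (fst.comp unpair))
  have neg : Primrec fun m : ℕ => m.unpair.1.unpair.2 := snd.comp (unpair.comp (fst.comp unpair))
  have den : Primrec fun m : ℕ => m.unpair.2 + 1 := succ.comp (snd.comp unpair)
  have h : PrimrecRel fun m n : ℕ =>
      m.unpair.1.unpair.1 * (n.unpair.2 + 1) + n.unpair.1.unpair.2 * (m.unpair.2 + 1) <
        n.unpair.1.unpair.1 * (m.unpair.2 + 1) + m.unpair.1.unpair.2 * (n.unpair.2 + 1) :=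
    nat_lt.comp
      (nat_add.comp (nat_mul.comp (num.comp fst) (den.comp snd))
        (nat_mul.comp (neg.comp snd) (den.comp fst)))
      (nat_add.comp (nat_mul.comp (num.comp snd) (den.comp fst))
        (nat_mul.comp (neg.comp fst) (den.comp snd)))
  refine h.of_eq fun m n => ?_
  rw [ratOfCode, ratOfCode, div_lt_div_iff₀ (by positivity) (by positivity),
    ← Nat.cast_lt (α := ℚ)]
  push_cast
  constructor <;> intro h <;> linarith

theorem primrecPred_abs_ratOfCode_sub_lt : PrimrecPred fun p : ℕ × ℕ × ℕ =>
    |ratOfCode p.2.1 - ratOfCode p.2.2| < ratOfCode p.1 := by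
  have h1 : PrimrecPred fun p : ℕ × ℕ × ℕ => ratOfCode p.2.1 < ratOfCode (addCode p.1 p.2.2) :=
    primrecRel_ratOfCode_lt.comp (fst.comp snd) (primrec₂_addCode.comp fst (snd.comp snd))
  have h2 : PrimrecPred fun p : ℕ × ℕ × ℕ => ratOfCode p.2.2 < ratOfCode (addCode p.1 p.2.1) :=
    primrecRel_ratOfCode_lt.comp (snd.comp snd) (primrec₂_addCode.comp fst (fst.comp snd))
  refine (h1.and h2).of_eq fun p => ?_
  rw [ratOfCode_addCode, ratOfCode_addCode, abs_sub_lt_iff, sub_lt_iff_lt_add, sub_lt_iff_lt_add]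

theorem primrecPred_ratOfCode_lt_abs_sub : PrimrecPred fun p : ℕ × ℕ × ℕ =>
    ratOfCode p.1 < |ratOfCode p.2.1 - ratOfCode p.2.2| := by
  have h1 : PrimrecPred fun p : ℕ × ℕ × ℕ => ratOfCode (addCode p.1 p.2.2) < ratOfCode p.2.1 :=
    primrecRel_ratOfCode_lt.comp (primrec₂_addCode.comp fst (snd.comp snd)) (fst.comp snd)
  have h2 : PrimrecPred fun p : ℕ × ℕ × ℕ => ratOfCode (addCode p.1 p.2.1) < ratOfCode p.2.2 :=
    primrecRel_ratOfCode_lt.comp (primrec₂_addCode.comp fst (fst.comp snd)) (snd.comp snd)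
  refine (h1.or h2).of_eq fun p => ?_
  rw [ratOfCode_addCode, ratOfCode_addCode, lt_abs, neg_sub, lt_sub_iff_add_lt,
    lt_sub_iff_add_lt]

end Primrec

/-! ### Recursively enumerable predicates -/

section RE

variable {α β : Type*} [Primcodable α] [Primcodable β]

theorem computablePred_comp {p : β → Prop} (hp : ComputablePred p) {u : α → β}
    (hu : Computable u) : ComputablePred fun a => p (u a) := by
  obtain ⟨_, h⟩ := hp
  exact ⟨fun a => inferInstance, h.comp hu⟩

theorem computablePred_and {p q : α → Prop} (hp : ComputablePred p) (hq : ComputablePred q) :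
    ComputablePred fun a => p a ∧ q a := by
  obtain ⟨_, hp⟩ := hp
  obtain ⟨_, hq⟩ := hq
  exact ⟨fun a => inferInstance,
    (Primrec.and.to_comp.comp hp hq).of_eq fun a => by simp⟩

theorem computablePred_ratOfCode_lt {u v : α → ℕ} (hu : Computable u)
    (hv : Computable v) : ComputablePred fun i => ratOfCode (u i) < ratOfCode (v i) :=
  (computablePred_comp (p := fun p : ℕ × ℕ => ratOfCode p.1 < ratOfCode p.2)
    (PrimrecPred.computablePred primrecRel_ratOfCode_lt) (hu.pair hv)).of_eq fun _ => Iff.rfl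

theorem computablePred_lt_abs_sub {u v w : α → ℕ} (hu : Computable u)
    (hv : Computable v) (hw : Computable w) :
    ComputablePred fun i => ratOfCode (u i) < |ratOfCode (v i) - ratOfCode (w i)| :=
  (computablePred_comp primrecPred_ratOfCode_lt_abs_sub.computablePred
    (hu.pair (hv.pair hw))).of_eq fun _ => Iff.rfl

theorem computablePred_abs_sub_lt {u v w : α → ℕ} (hu : Computable u)
    (hv : Computable v) (hw : Computable w) :
    ComputablePred fun i => |ratOfCode (v i) - ratOfCode (w i)| < ratOfCode (u i) :=
  (computablePred_comp primrecPred_abs_ratOfCode_sub_lt.computablePred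
    (hu.pair (hv.pair hw))).of_eq fun _ => Iff.rfl

theorem rePred_exists_mem {f : α →. β} (hf : Partrec f) {Q : α → β → Prop}
    (hQ : ComputablePred fun p : α × β => Q p.1 p.2) : REPred fun a => ∃ b ∈ f a, Q a b := by
  classical
  replace hQ := hQ.decide
  have : Partrec₂ fun (a : α) (b : β) =>
      bif decide (Q a b) then Part.some () else Part.none :=
    Partrec.cond hQ (Computable.const ()).partrec Partrec.none
  refine (hf.bind this).dom_re.of_eq fun a => ?_
  simp only [Part.bind_dom]
  constructor
  · rintro ⟨h, hd⟩
    refine ⟨_, Part.get_mem h, ?_⟩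
    by_contra hn
    simp [hn] at hd
  · rintro ⟨b, hb, hq⟩
    obtain ⟨h, rfl⟩ := hb
    exact ⟨h, by simp [hq]⟩

theorem rfind_some_dom (p : ℕ → Bool) :
    (Nat.rfind fun n => Part.some (p n)).Dom ↔ ∃ n, p n = true :=
  Nat.rfind_dom'.trans
    ⟨fun ⟨n, hn, _⟩ => ⟨n, (Part.mem_some_iff.1 hn).symm⟩,
      fun ⟨n, hn⟩ => ⟨n, Part.mem_some_iff.2 hn.symm, fun _ => trivial⟩⟩

theorem rePred_exists {Q : α → ℕ → Prop} (hQ : ComputablePred fun p : α × ℕ => Q p.1 p.2) :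
    REPred fun a => ∃ n, Q a n := by
  classical
  replace hQ := hQ.decide
  have : Partrec fun a => Nat.rfind fun n => Part.some (decide (Q a n)) :=
    Partrec.rfind hQ.partrec
  refine this.dom_re.of_eq fun a => ?_
  exact (rfind_some_dom _).trans (by simp)

/-- A recursively enumerable predicate is enumerated in computable stages. -/
theorem rePred_exists_stage {p : α → Prop} (hp : REPred p) :
    ∃ H : α → ℕ → Bool, Computable₂ H ∧ (∀ a m n, m ≤ n → H a m = true → H a n = true) ∧
      ∀ a, p a ↔ ∃ n, H a n = true := by
  obtain ⟨c, hc⟩ := Nat.Partrec.Code.exists_code.1 hp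
  refine ⟨fun a n => (Nat.Partrec.Code.evaln n c (Encodable.encode a)).isSome, ?_, ?_, ?_⟩
  · exact (Primrec.option_isSome.comp (Nat.Partrec.Code.primrec_evaln.comp
      (Primrec.pair (Primrec.pair Primrec.snd (Primrec.const c))
        (Primrec.encode.comp Primrec.fst)))).to_comp
  · intro a m n hmn h
    obtain ⟨x, hx⟩ := Option.isSome_iff_exists.1 h
    exact Option.isSome_iff_exists.2 ⟨x, Nat.Partrec.Code.evaln_mono hmn hx⟩
  · intro a
    have h1 : p a ↔ (c.eval (Encodable.encode a)).Dom := by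
      rw [hc]
      simp [Part.assert, Part.bind]
    rw [h1, Part.dom_iff_mem]
    constructor
    · rintro ⟨y, hy⟩
      obtain ⟨k, hk⟩ := Nat.Partrec.Code.evaln_complete.1 hy
      exact ⟨k, Option.isSome_iff_exists.2 ⟨y, hk⟩⟩
    · rintro ⟨k, hk⟩
      obtain ⟨x, hx⟩ := Option.isSome_iff_exists.1 hk
      exact ⟨x, Nat.Partrec.Code.evaln_sound hx⟩

/-- A recursively enumerable relation has a partial recursive choice function. -/
theorem rePred_exists_partrec_choice {R : α → ℕ → Prop}
    (hR : REPred fun p : α × ℕ => R p.1 p.2) :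
    ∃ sel : α →. ℕ, Partrec sel ∧ (∀ a, ∀ m ∈ sel a, R a m) ∧
      ∀ a m, R a m → (sel a).Dom := by
  obtain ⟨H, hH, -, hiff⟩ := rePred_exists_stage hR
  have hH' : Computable₂ fun (a : α) (w : ℕ) => H (a, w.unpair.1) w.unpair.2 :=
    hH.comp (Computable.pair Computable.fst
      (Computable.fst.comp (Computable.unpair.comp Computable.snd)))
      (Computable.snd.comp (Computable.unpair.comp Computable.snd))
  refine ⟨fun a => (Nat.rfind fun w => Part.some (H (a, w.unpair.1) w.unpair.2)).map
    fun w => w.unpair.1, ?_, ?_, ?_⟩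
  · exact (Partrec.rfind hH'.partrec₂).map
      (Computable.fst.comp (Computable.unpair.comp Computable.snd)).to₂
  · intro a m hm
    obtain ⟨w, hw, rfl⟩ := (Part.mem_map_iff _).1 hm
    have := Nat.rfind_spec hw
    exact (hiff (a, w.unpair.1)).2 ⟨w.unpair.2, (Part.mem_some_iff.1 this).symm⟩
  · intro a m h
    obtain ⟨n, hn⟩ := (hiff (a, m)).1 h
    exact (rfind_some_dom _).2 ⟨Nat.pair m n, by simpa using hn⟩

end RE

/-! ### The jump decides halting -/

namespace OracleCode

/-- A program that outputs `n` on every input. -/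
def const : ℕ → OracleCode
  | 0 => zero
  | n + 1 => comp succ (const n)

theorem eval_const (A : Set ℕ) (n m : ℕ) : (const n).eval A m = Part.some n := by
  induction n with
  | zero => rfl
  | succ n ih => simp [const, eval, ih]

theorem primrec_index_const : Primrec fun n => (const n).index := by
  have h : Primrec fun n : ℕ => n.rec (motive := fun _ => ℕ) 0 fun _ i => 4 * Nat.pair 1 i + 6 :=
    Primrec.nat_rec₁ 0 (Primrec.nat_add.comp
      (Primrec.nat_mul.comp (Primrec.const 4)
        (Primrec₂.natPair.comp (Primrec.const 1) Primrec.snd)) (Primrec.const 6)).to₂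
  refine h.of_eq fun n => ?_
  induction n with
  | zero => rfl
  | succ n ih => simp only [const, index, ← ih]

end OracleCode

/-- The jump of `A` decides whether a partial function recursive in `A` is defined. The program
whose membership in `jump A` is queried ignores its input and runs the given one on `n`. -/
theorem exists_computableIn_jump_eq_zero_iff {A : Set ℕ} {g : ℕ →. ℕ}
    (hg : RecursiveIn {charFun A} g) :
    ∃ χ : ℕ → ℕ, ComputableIn {charFun (jump A)} χ ∧ ∀ n, χ n = 0 ↔ ¬(g n).Dom := by
  classical
  obtain ⟨c, hc⟩ := (OracleCode.exists_eval_iff A g).2 (RecursiveIn.iff_nat.1 hg)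
  let e : ℕ → ℕ := fun n => (OracleCode.comp c (OracleCode.const n)).index
  have he : Primrec e := Primrec.nat_add.comp
    (Primrec.nat_mul.comp (Primrec.const 4)
      (Primrec₂.natPair.comp (Primrec.const _) OracleCode.primrec_index_const)) (Primrec.const 6)
  refine ⟨fun n => if e n ∈ jump A then 1 else 0, ?_, ?_⟩
  · have h : Nat.RecursiveIn {charFun (jump A)} _ :=
      Nat.RecursiveIn.comp (Nat.RecursiveIn.oracle _ (Set.mem_singleton (charFun (jump A))))
        (RecursiveIn.iff_nat.1 he.computableIn)
    refine RecursiveIn.iff_nat.2 (h.of_eq fun n => ?_)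
    refine (Part.bind_some (e n) (charFun (jump A))).trans ?_
    simp only [charFun]
  · intro n
    have heval (m : ℕ) : (OracleCode.comp c (OracleCode.const m)).eval A (e m) = c.eval A m := by
      change ((OracleCode.const m).eval A (e m)).bind (c.eval A) = _
      rw [OracleCode.eval_const]
      exact Part.bind_some m (c.eval A)
    have hmem : e n ∈ jump A ↔ (g n).Dom := by
      rw [← hc]
      constructor
      · rintro ⟨d, hd, hdom⟩
        rw [OracleCode.index_bijective.1 hd] at hdom
        exact (heval n ▸ hdom :)
      · intro h
        exact ⟨_, rfl, (heval n).symm ▸ h⟩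
    simp [hmem]

theorem exists_computableIn_emptyJump_one {P : ℕ → Prop} (hP : REPred P) :
    ∃ χ : ℕ → ℕ, ComputableIn {charFun (emptyJump 1)} χ ∧ ∀ n, χ n = 0 ↔ ¬P n := by
  have hP' : Partrec fun n => (Part.assert (P n) fun _ => Part.some ()).map fun _ => (0 : ℕ) :=
    hP.map (Computable.const 0).to₂
  obtain ⟨χ, hχ, h⟩ := exists_computableIn_jump_eq_zero_iff (A := ∅) hP'.recursiveIn
  refine ⟨χ, hχ, fun n => (h n).trans ?_⟩
  simp [Part.assert]

theorem RecursiveIn.rfind_eq_zero {O : Set (ℕ →. ℕ)} {χ : ℕ → ℕ} (hχ : ComputableIn O χ) :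
    RecursiveIn O fun a => Nat.rfind fun n => Part.some (decide (χ (Nat.pair a n) = 0)) := by
  refine RecursiveIn.iff_nat.2 ((Nat.RecursiveIn.rfind (RecursiveIn.iff_nat.1 hχ)).of_eq ?_)
  intro a
  simp

theorem ComputableIn.exists_least {O : Set (ℕ →. ℕ)} {χ : ℕ → ℕ} (hχ : ComputableIn O χ)
    (h : ∀ a, ∃ n, χ (Nat.pair a n) = 0) :
    ∃ g : ℕ → ℕ, ComputableIn O g ∧
      ∀ a, χ (Nat.pair a (g a)) = 0 ∧ ∀ m < g a, χ (Nat.pair a m) ≠ 0 := by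
  refine ⟨fun a => Nat.find (h a), RecursiveIn.of_eq_tot (RecursiveIn.rfind_eq_zero hχ) ?_,
    fun a => ⟨Nat.find_spec (h a), fun m => Nat.find_min (h a)⟩⟩
  intro a
  exact Nat.mem_rfind.2 ⟨by simpa using Nat.find_spec (h a),
    fun {m} hm => by simpa using Nat.find_min (h a) hm⟩

theorem ComputableIn.comp_nat {O : Set (ℕ →. ℕ)} {g h : ℕ → ℕ} (hg : ComputableIn O g)
    (hh : ComputableIn O h) : ComputableIn O fun n => g (h n) :=
  RecursiveIn.iff_nat.2 ((Nat.RecursiveIn.comp (RecursiveIn.iff_nat.1 hg)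
    (RecursiveIn.iff_nat.1 hh)).of_eq fun n => by simp)

/-! ### Names of reals -/

theorem IsCauchyName.abs_sub_le {q : ℕ → ℚ} {x : ℝ} (h : IsCauchyName q x) (n : ℕ) :
    |(q n : ℝ) - x| ≤ (2 : ℝ)⁻¹ ^ n := by
  rw [abs_sub_comm]
  refine le_of_tendsto ((h.2.sub_const (q n : ℝ)).abs) ?_
  filter_upwards [Filter.eventually_ge_atTop n] with k hk
  have := h.1 n k hk
  rify at this
  exact this

theorem isCauchyName_of_abs_sub_le {q : ℕ → ℚ} {x : ℝ}
    (h1 : ∀ n k, n ≤ k → |q k - q n| ≤ (2 : ℚ)⁻¹ ^ n)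
    (h2 : ∀ n, |(q n : ℝ) - x| ≤ (2 : ℝ)⁻¹ ^ n) : IsCauchyName q x := by
  refine ⟨h1, tendsto_iff_dist_tendsto_zero.2 ?_⟩
  exact squeeze_zero (fun _ => dist_nonneg) h2
    (tendsto_pow_atTop_nhds_zero_of_lt_one (by norm_num) (by norm_num))

theorem isCauchyName_const (q : ℚ) : IsCauchyName (fun _ => q) q :=
  ⟨fun n k _ => by simp, tendsto_const_nhds⟩

theorem isNameIndex_const (m : ℕ) :
    IsNameIndex (Nat.Partrec.Code.const m) (ratOfCode m : ℝ) :=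
  ⟨fun _ => m, fun n => Nat.Partrec.Code.eval_const m n, isCauchyName_const _⟩

/-- The computable real with a given code of a rational. -/
noncomputable def codedRat (m : ℕ) : Rc :=
  ⟨ratOfCode m, fun _ => m, Computable.const m, isCauchyName_const _⟩

theorem denseRange_codedRat : DenseRange codedRat := by
  rw [Metric.denseRange_iff]
  intro x r hr
  obtain ⟨q, hq1, hq2⟩ := exists_rat_btwn (show (x : ℝ) < x + r by linarith)
  obtain ⟨m, rfl⟩ := ratOfCode_surjective q
  refine ⟨m, ?_⟩
  rw [Subtype.dist_eq, Real.dist_eq, abs_lt]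
  simp only [codedRat]
  constructor <;> linarith

theorem exists_isNameIndex (x : Rc) : ∃ (c : Nat.Partrec.Code) (g : ℕ → ℕ), Computable g ∧
    (∀ n, c.eval n = Part.some (g n)) ∧ IsCauchyName (fun n => ratOfCode (g n)) x := by
  obtain ⟨g, hg, hx⟩ := x.2
  obtain ⟨c, hc⟩ := Nat.Partrec.Code.exists_code.1 (Partrec.nat_iff.1 hg.partrec)
  exact ⟨c, g, hg, fun n => congrFun hc n, hx⟩

/-! ### Continuity of Markov computable functions -/

/-- `F` realizes `f`: it maps every index of a name of `x` to an index of a name of `f x`. -/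
def Realizes (F : Nat.Partrec.Code →. Nat.Partrec.Code) (f : Rc → Rc) : Prop :=
  ∀ (x : Rc) (c : Nat.Partrec.Code), IsNameIndex c x → ∃ d ∈ F c, IsNameIndex d (f x)

/-- The `K`-th entry of the sequence with index `F c`. If `F` realizes `f` and `c` is an index of
a name of `x`, it is a code of a rational at distance at most `2⁻ᴷ` from `f x`. -/
def imageEntry (F : Nat.Partrec.Code →. Nat.Partrec.Code) (c : Nat.Partrec.Code) (K : ℕ) :
    Part ℕ :=
  (F c).bind fun d => d.eval K

theorem partrec₂_imageEntry {F : Nat.Partrec.Code →. Nat.Partrec.Code} (hF : Partrec F) :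
    Partrec₂ (imageEntry F) :=
  (hF.comp Computable.fst).bind
    (Nat.Partrec.Code.eval_part.comp Computable.snd (Computable.snd.comp Computable.fst))

theorem Realizes.exists_mem_imageEntry {F : Nat.Partrec.Code →. Nat.Partrec.Code} {f : Rc → Rc}
    (hF : Realizes F f) {x : Rc} {c : Nat.Partrec.Code} (hc : IsNameIndex c x) (K : ℕ) :
    ∃ v ∈ imageEntry F c K, |(ratOfCode v : ℝ) - f x| ≤ (2 : ℝ)⁻¹ ^ K := by
  obtain ⟨d, hd, g, hg, hname⟩ := hF x c hc
  exact ⟨g K, Part.mem_bind hd (by rw [hg]; exact Part.mem_some _), hname.abs_sub_le K⟩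

theorem Realizes.abs_sub_le {F : Nat.Partrec.Code →. Nat.Partrec.Code} {f : Rc → Rc}
    (hF : Realizes F f) {x : Rc} {c : Nat.Partrec.Code} (hc : IsNameIndex c x) {K v : ℕ}
    (hv : v ∈ imageEntry F c K) : |(ratOfCode v : ℝ) - f x| ≤ (2 : ℝ)⁻¹ ^ K := by
  obtain ⟨w, hw, h⟩ := hF.exists_mem_imageEntry hc K
  rwa [Part.mem_unique hv hw]

/-- The recursion theorem applied to the following program `c`, which knows a name of `x`. As long
as the event `P c` has not been observed, it outputs the entries of the name, shifted by one.
When the event is observed at stage `s`, the program searches for a rational that satisfies `Far`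
and is so close to `x` that the entries output so far remain part of a name of it, and from then
on outputs this rational. -/
theorem exists_selfReferential_index {x : Rc} {g : ℕ → ℕ} (hg : Computable g)
    (hx : IsCauchyName (fun n => ratOfCode (g n)) x) {P : Nat.Partrec.Code → Prop}
    (hP : REPred P) {Far : ℕ → Prop} (hFar : REPred fun p : ℕ × ℕ => Far p.2 ∧
      ¬ratOfCode (dyadicCode 1 (p.1 + 1)) < |ratOfCode p.2 - ratOfCode (g (p.1 + 2))|) :
    ∃ c : Nat.Partrec.Code, (¬P c → IsNameIndex c x) ∧
      (P c → ∃ δ > 0, ∀ m, |(ratOfCode m : ℝ) - x| < δ → Far m →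
        ∃ m', Far m' ∧ IsNameIndex c (ratOfCode m' : ℝ)) := by
  obtain ⟨H, hH, hmono, hiff⟩ := rePred_exists_stage hP
  obtain ⟨sel, hsel, hsel1, hsel2⟩ := rePred_exists_partrec_choice (R := fun s m => Far m ∧
      ¬ratOfCode (dyadicCode 1 (s + 1)) < |ratOfCode m - ratOfCode (g (s + 2))|) hFar
  let G : Nat.Partrec.Code → ℕ →. ℕ := fun c n =>
    bif H c n then (Nat.rfind fun k => Part.some (H c k)).bind sel else Part.some (g (n + 1))
  have hG : Partrec₂ G := by
    refine Partrec.cond hH ?_ (hg.comp (Computable.succ.comp Computable.snd)).partrec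
    refine Partrec.bind (Partrec.rfind ?_) (hsel.comp Computable.snd).to₂
    exact (hH.comp (Computable.fst.comp Computable.fst) Computable.snd).partrec
  obtain ⟨c, hc⟩ := Nat.Partrec.Code.fixed_point₂ hG
  have hbefore (n : ℕ) (hn : H c n = false) : c.eval n = Part.some (g (n + 1)) := by
    rw [hc]
    simp only [G, hn, cond_false]
  refine ⟨c, ?_, ?_⟩
  · intro hPc
    refine ⟨fun n => g (n + 1), fun n => hbefore n ?_, ?_⟩
    · by_contra h
      exact hPc ((hiff c).2 ⟨n, by simpa using h⟩)
    · refine ⟨fun n k hnk => (hx.1 (n + 1) (k + 1) (by omega)).trans ?_,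
        hx.2.comp (Filter.tendsto_add_atTop_nat 1)⟩
      exact pow_le_pow_of_le_one (by norm_num) (by norm_num) (by omega)
  · intro hPc
    have hex := (hiff c).1 hPc
    set s := Nat.find hex with hs
    have hHs : H c s = true := Nat.find_spec hex
    have hmin (n : ℕ) (hn : n < s) : H c n = false := by
      simpa using Nat.find_min hex hn
    refine ⟨(2 : ℝ)⁻¹ ^ (s + 2), by positivity, fun m hm hfar => ?_⟩
    have hclose : ¬ratOfCode (dyadicCode 1 (s + 1)) < |ratOfCode m - ratOfCode (g (s + 2))| := by
      rw [not_lt, ratOfCode_dyadicCode, ← Rat.cast_le (K := ℝ)]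
      push_cast
      have h1 := hx.abs_sub_le (s + 2)
      rw [abs_sub_comm] at h1
      have h2 := abs_sub_le (ratOfCode m : ℝ) x (ratOfCode (g (s + 2)))
      have h3 : (2 : ℝ)⁻¹ ^ (s + 1) = 2 * (2 : ℝ)⁻¹ ^ (s + 2) := by ring
      linarith
    obtain ⟨m', hm'⟩ := Part.dom_iff_mem.1 (hsel2 s m ⟨hfar, hclose⟩)
    obtain ⟨hfar', hclose'⟩ := hsel1 s m' hm'
    have hafter (n : ℕ) (hn : s ≤ n) : c.eval n = Part.some m' := by
      rw [hc]
      simp only [G, hmono c s n hn hHs, cond_true]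
      refine Part.eq_some_iff.2 (Part.mem_bind (Nat.mem_rfind.2 ⟨?_, ?_⟩) hm')
      · simp [hHs]
      · intro k hk
        simp [hmin k hk]
    -- The entries before stage `s` are close enough to `m'` because those of the name were
    -- shifted by one.
    have hdist (n : ℕ) (hn : n < s) : |ratOfCode m' - ratOfCode (g (n + 1))| ≤ (2 : ℚ)⁻¹ ^ n := by
      rw [not_lt, ratOfCode_dyadicCode, Nat.cast_one, one_mul] at hclose'
      have h1 := hx.1 (n + 1) (s + 2) (by omega)
      have h2 := abs_sub_le (ratOfCode m') (ratOfCode (g (s + 2))) (ratOfCode (g (n + 1)))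
      have h3 : (2 : ℚ)⁻¹ ^ (s + 1) ≤ (2 : ℚ)⁻¹ ^ (n + 1) :=
        pow_le_pow_of_le_one (by norm_num) (by norm_num) (by omega)
      have h4 : (2 : ℚ)⁻¹ ^ n = 2 * (2 : ℚ)⁻¹ ^ (n + 1) := by ring
      linarith
    refine ⟨m', hfar', fun n => if n < s then g (n + 1) else m', fun n => ?_, ?_, ?_⟩
    · beta_reduce
      split_ifs with h
      · exact hbefore n (hmin n h)
      · exact hafter n (not_lt.1 h)
    · intro n k hnk
      by_cases hn : n < s
      · by_cases hk : k < s
        · simp only [hn, hk, if_true]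
          refine (hx.1 (n + 1) (k + 1) (by omega)).trans ?_
          exact pow_le_pow_of_le_one (by norm_num) (by norm_num) (by omega)
        · simp only [hn, hk, if_true, if_false]
          exact hdist n hn
      · have hk : ¬k < s := by omega
        simp [hn, hk]
    · refine tendsto_const_nhds.congr' ?_
      filter_upwards [Filter.eventually_ge_atTop s] with n hn
      simp [not_lt.2 hn]

theorem rePred_far_and_close {F : Nat.Partrec.Code →. Nat.Partrec.Code} (hpart : Partrec F)
    {g : ℕ → ℕ} (hg : Computable g) (K a b : ℕ) : REPred fun p : ℕ × ℕ =>
      (∃ v ∈ imageEntry F (Nat.Partrec.Code.const p.2) K,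
        ratOfCode b < |ratOfCode v - ratOfCode a|) ∧
      ¬ratOfCode (dyadicCode 1 (p.1 + 1)) < |ratOfCode p.2 - ratOfCode (g (p.1 + 2))| := by
  have h1 : Partrec fun p : ℕ × ℕ => imageEntry F (Nat.Partrec.Code.const p.2) K :=
    (partrec₂_imageEntry hpart).comp
      (Nat.Partrec.Code.primrec_const.to_comp.comp Computable.snd) (Computable.const K)
  have h2 : Computable fun p : (ℕ × ℕ) × ℕ => p.1.1 := Computable.fst.comp Computable.fst
  have h3 : Computable fun p : (ℕ × ℕ) × ℕ => dyadicCode 1 (p.1.1 + 1) :=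
    primrec₂_dyadicCode.to_comp.comp (Computable.const 1) (Computable.succ.comp h2)
  have h4 : Computable fun p : (ℕ × ℕ) × ℕ => g (p.1.1 + 2) :=
    hg.comp (Computable.succ.comp (Computable.succ.comp h2))
  have h5 := computablePred_lt_abs_sub (Computable.const b)
    (Computable.snd (α := ℕ × ℕ) (β := ℕ)) (Computable.const a)
  have h6 := (computablePred_lt_abs_sub h3
    (Computable.snd.comp (Computable.fst (α := ℕ × ℕ) (β := ℕ))) h4).not
  refine (rePred_exists_mem (Q := fun p v => ratOfCode b < |ratOfCode v - ratOfCode a| ∧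
    ¬ratOfCode (dyadicCode 1 (p.1 + 1)) < |ratOfCode p.2 - ratOfCode (g (p.1 + 2))|)
    h1 (computablePred_and h5 h6)).of_eq fun p => ?_
  exact ⟨fun ⟨v, hv, h, h'⟩ => ⟨⟨v, hv, h⟩, h'⟩, fun ⟨⟨v, hv, h⟩, h'⟩ => ⟨v, hv, h, h'⟩⟩

/-- With an approximation `a` of `f x` up to `2⁻ᴷ`, the self-referential index `c` is applied to
the event that the `K`-th approximation of the value at `c` is within `2 * 2⁻ᴷ` of `a`. The event
occurs, since otherwise `c` would name `x`. If `c` then named a rational whose own approximate value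
differs from `a` by more than `4 * 2⁻ᴷ`, two approximations of the same value would be too far
apart. -/
theorem Realizes.exists_nhds_codedRat {F : Nat.Partrec.Code →. Nat.Partrec.Code} {f : Rc → Rc}
    (hpart : Partrec F) (hF : Realizes F f) (x : Rc) (K : ℕ) :
    ∃ δ > 0, ∀ m, |(ratOfCode m : ℝ) - x| < δ →
      |(f (codedRat m) : ℝ) - f x| ≤ 6 * (2 : ℝ)⁻¹ ^ K := by
  obtain ⟨c₀, g, hg, hc₀, hx⟩ := exists_isNameIndex x
  obtain ⟨a, -, ha⟩ := hF.exists_mem_imageEntry ⟨g, hc₀, hx⟩ K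
  -- The event waited for is that the value at `c` is seen to be close to `f x`; the rationals
  -- searched for are those at which the value is seen not to be close to `f x`.
  let P : Nat.Partrec.Code → Prop := fun c => ∃ v ∈ imageEntry F c K,
    ¬ratOfCode (dyadicCode 2 K) < |ratOfCode v - ratOfCode a|
  let Far : ℕ → Prop := fun m => ∃ v ∈ imageEntry F (Nat.Partrec.Code.const m) K,
    ratOfCode (dyadicCode 4 K) < |ratOfCode v - ratOfCode a|
  have hP : REPred P := rePred_exists_mem
    ((partrec₂_imageEntry hpart).comp Computable.id (Computable.const K))
    (computablePred_lt_abs_sub (Computable.const _) Computable.snd (Computable.const a)).not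
  have hFar : REPred fun p : ℕ × ℕ => Far p.2 ∧
      ¬ratOfCode (dyadicCode 1 (p.1 + 1)) < |ratOfCode p.2 - ratOfCode (g (p.1 + 2))| := by
    exact rePred_far_and_close hpart hg K a _
  obtain ⟨c, hc1, hc2⟩ := exists_selfReferential_index hg hx hP hFar
  have hPc : P c := by
    by_contra hn
    obtain ⟨v, hv, h⟩ := hF.exists_mem_imageEntry (hc1 hn) K
    refine hn ⟨v, hv, ?_⟩
    rw [not_lt, ratOfCode_dyadicCode, ← Rat.cast_le (K := ℝ)]
    push_cast
    rw [abs_le] at *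
    constructor <;> linarith
  obtain ⟨δ, hδ, hnear⟩ := hc2 hPc
  refine ⟨δ, hδ, fun m hm => ?_⟩
  have hnot : ¬Far m := by
    intro hfar
    obtain ⟨m', ⟨v', hv', h'⟩, hidx⟩ := hnear m hm hfar
    obtain ⟨v, hv, h⟩ := hPc
    have e1 := hF.abs_sub_le (x := codedRat m') hidx hv
    have e2 := hF.abs_sub_le (x := codedRat m') (isNameIndex_const m') hv'
    rw [not_lt, ratOfCode_dyadicCode, ← Rat.cast_le (K := ℝ)] at h
    rw [ratOfCode_dyadicCode, ← Rat.cast_lt (K := ℝ)] at h'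
    push_cast at h h'
    rw [abs_le] at h e1 e2
    rw [lt_abs] at h'
    rcases h' with h' | h' <;> linarith
  obtain ⟨v, hv, h⟩ := hF.exists_mem_imageEntry (x := codedRat m) (isNameIndex_const m) K
  have hv4 : ¬ratOfCode (dyadicCode 4 K) < |ratOfCode v - ratOfCode a| :=
    fun hlt => hnot ⟨v, hv, hlt⟩
  rw [not_lt, ratOfCode_dyadicCode, ← Rat.cast_le (K := ℝ)] at hv4
  push_cast at hv4
  rw [abs_le] at *
  constructor <;> linarith

/-- The theorem of Kreisel, Lacombe, Shoenfield and Tseitin: every Markov computable function on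
`ℝ_c` is continuous. -/
theorem IsMarkovComputable.continuous {f : Rc → Rc} (hf : IsMarkovComputable f) :
    Continuous f := by
  obtain ⟨F, hpart, hF⟩ := hf
  rw [Metric.continuous_iff]
  intro x ε hε
  obtain ⟨K, hK⟩ := exists_pow_lt_of_lt_one (show (0 : ℝ) < ε / 12 by linarith)
    (show (2 : ℝ)⁻¹ < 1 by norm_num)
  obtain ⟨δ, hδ, h⟩ := Realizes.exists_nhds_codedRat hpart hF x K
  refine ⟨δ, hδ, fun y hy => ?_⟩
  -- `f y` is compared with `f x` through a rational that is close both to `x` and to `y`.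
  obtain ⟨δ', hδ', h'⟩ := Realizes.exists_nhds_codedRat hpart hF y K
  have hopen : IsOpen (Metric.ball x δ ∩ Metric.ball y δ') :=
    Metric.isOpen_ball.inter Metric.isOpen_ball
  obtain ⟨m, hm⟩ := denseRange_codedRat.exists_mem_open hopen ⟨y, hy, Metric.mem_ball_self hδ'⟩
  have h1 := h m hm.1
  have h2 := h' m hm.2
  rw [Subtype.dist_eq, Real.dist_eq, abs_lt]
  rw [abs_le] at h1 h2
  constructor <;> linarith

/-! ### Oscillation -/

/-- Some two computable reals below `b` at distance less than `δ` have images at distance greater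
than `ε`. All inequalities are strict, so that for continuous `f` this is an open condition on the
two points, which may then be taken rational. -/
def Oscillates (f : Rc → Rc) (ε δ b : ℝ) : Prop :=
  ∃ x y : Rc, (x : ℝ) < b ∧ (y : ℝ) < b ∧ |(x : ℝ) - y| < δ ∧ ε < |(f x : ℝ) - f y|

theorem Oscillates.mono {f : Rc → Rc} {ε δ b b' : ℝ} (h : Oscillates f ε δ b) (hb : b ≤ b') :
    Oscillates f ε δ b' := by
  obtain ⟨x, y, hx, hy, h⟩ := h
  exact ⟨x, y, hx.trans_le hb, hy.trans_le hb, h⟩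

theorem oscillates_iff_codedRat {f : Rc → Rc} (hf : Continuous f) {ε δ b : ℝ} :
    Oscillates f ε δ b ↔ ∃ p q : ℕ, (ratOfCode p : ℝ) < b ∧ (ratOfCode q : ℝ) < b ∧
      |(ratOfCode p : ℝ) - ratOfCode q| < δ ∧
        ε < |(f (codedRat p) : ℝ) - f (codedRat q)| := by
  refine ⟨fun ⟨x, y, h⟩ => ?_, fun ⟨p, q, h⟩ => ⟨codedRat p, codedRat q, h⟩⟩
  let U : Set (Rc × Rc) := {z | (z.1 : ℝ) < b ∧ (z.2 : ℝ) < b ∧ |(z.1 : ℝ) - z.2| < δ ∧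
    ε < |(f z.1 : ℝ) - f z.2|}
  have hU : IsOpen U := by
    have h1 : Continuous fun z : Rc × Rc => (z.1 : ℝ) := by fun_prop
    have h2 : Continuous fun z : Rc × Rc => (z.2 : ℝ) := by fun_prop
    have h3 : Continuous fun z : Rc × Rc => (f z.1 : ℝ) := by fun_prop
    have h4 : Continuous fun z : Rc × Rc => (f z.2 : ℝ) := by fun_prop
    exact (isOpen_lt h1 continuous_const).inter ((isOpen_lt h2 continuous_const).inter
      ((isOpen_lt (h1.sub h2).abs continuous_const).inter
        (isOpen_lt continuous_const (h3.sub h4).abs)))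
  obtain ⟨⟨p, q⟩, hpq⟩ :=
    (denseRange_codedRat.prodMap denseRange_codedRat).exists_mem_open hU ⟨(x, y), h⟩
  exact ⟨p, q, hpq⟩

/-- Pairs of close points that are not both below `b` lie in `[1, ∞)`, where `f` is constant. -/
theorem abs_sub_le_of_not_oscillates {f : Rc → Rc}
    (hright : ∀ x y : Rc, 1 ≤ (x : ℝ) → 1 ≤ (y : ℝ) → f x = f y) {ε δ b : ℝ} (hε : 0 ≤ ε)
    (hb : 1 + δ ≤ b) (h : ¬Oscillates f ε δ b) {x y : Rc} (hxy : |(x : ℝ) - y| < δ) :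
    |(f x : ℝ) - f y| ≤ ε := by
  by_cases hlt : (x : ℝ) < b ∧ (y : ℝ) < b
  · by_contra hn
    exact h ⟨x, y, hlt.1, hlt.2, hxy, not_le.1 hn⟩
  · have hδ := abs_sub_lt_iff.1 hxy
    have hδ0 : 0 < δ := (abs_nonneg _).trans_lt hxy
    have : f x = f y := by
      rw [not_and_or, not_lt, not_lt] at hlt
      refine hright x y ?_ ?_ <;> rcases hlt with hlt | hlt <;> linarith
    simpa [this] using hε

theorem uniformContinuous_of_not_oscillates {f : Rc → Rc}
    (hright : ∀ x y : Rc, 1 ≤ (x : ℝ) → 1 ≤ (y : ℝ) → f x = f y)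
    (h : ∀ e, 0 < ratOfCode e → ∃ n : ℕ, ¬Oscillates f (ratOfCode e) ((2 : ℝ)⁻¹ ^ n) 2) :
    UniformContinuous f := by
  rw [Metric.uniformContinuous_iff]
  intro ε hε
  obtain ⟨q, hq0, hqε⟩ := exists_rat_btwn hε
  obtain ⟨e, rfl⟩ := ratOfCode_surjective q
  obtain ⟨n, hn⟩ := h e (by exact_mod_cast hq0)
  refine ⟨(2 : ℝ)⁻¹ ^ n, by positivity, fun x y hxy => ?_⟩
  have h1 : (2 : ℝ)⁻¹ ^ n ≤ 1 := pow_le_one₀ (by norm_num) (by norm_num)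
  exact (abs_sub_le_of_not_oscillates hright hq0.le (by linarith) hn hxy).trans_lt hqε

theorem exists_not_oscillates {f : Rc → Rc} (hf : UniformContinuous f) {ε : ℝ} (hε : 0 < ε)
    (b : ℝ) : ∃ n : ℕ, ¬Oscillates f ε ((2 : ℝ)⁻¹ ^ n) b := by
  obtain ⟨δ, hδ, h⟩ := Metric.uniformContinuous_iff.1 hf ε hε
  obtain ⟨n, hn⟩ := exists_pow_lt_of_lt_one hδ (show (2 : ℝ)⁻¹ < 1 by norm_num)
  exact ⟨n, fun ⟨x, y, _, _, hxy, hlt⟩ => lt_asymm hlt (h (hxy.trans hn))⟩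

theorem exists_computable₂_approx {f : Rc → Rc} (hf : IsMarkovComputable f) :
    ∃ g : ℕ → ℕ → ℕ, Computable₂ g ∧
      ∀ m K, |(ratOfCode (g m K) : ℝ) - f (codedRat m)| ≤ (2 : ℝ)⁻¹ ^ K := by
  obtain ⟨F, hpart, hF⟩ := hf
  choose g hg1 hg2 using fun m K =>
    Realizes.exists_mem_imageEntry hF (x := codedRat m) (isNameIndex_const m) K
  refine ⟨g, ?_, hg2⟩
  exact Partrec.of_eq_tot ((partrec₂_imageEntry hpart).comp
    (Nat.Partrec.Code.primrec_const.to_comp.comp Computable.fst) Computable.snd)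
    fun p => hg1 p.1 p.2

/-- Oscillation of a Markov computable function is recursively enumerable: it is witnessed by two
rationals and by approximations of their images that are precise enough. -/
theorem rePred_oscillates {f : Rc → Rc} (hf : IsMarkovComputable f) {e d b : ℕ → ℕ}
    (he : Computable e) (hd : Computable d) (hb : Computable b) :
    REPred fun n => Oscillates f (ratOfCode (e n)) (ratOfCode (d n)) (ratOfCode (b n)) := by
  obtain ⟨g, hg, happrox⟩ := exists_computable₂_approx hf
  let Q : ℕ → ℕ → Prop := fun n w =>
    (ratOfCode w.unpair.1.unpair.1 < ratOfCode (b n) ∧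
      ratOfCode w.unpair.1.unpair.2 < ratOfCode (b n)) ∧
    |ratOfCode w.unpair.1.unpair.1 - ratOfCode w.unpair.1.unpair.2| < ratOfCode (d n) ∧
    ratOfCode (addCode (e n) (dyadicCode 2 w.unpair.2)) <
      |ratOfCode (g w.unpair.1.unpair.1 w.unpair.2) -
        ratOfCode (g w.unpair.1.unpair.2 w.unpair.2)|
  have hQ : ComputablePred fun p : ℕ × ℕ => Q p.1 p.2 := by
    have fst : Computable fun p : ℕ × ℕ => p.1 := Computable.fst
    have k1 : Computable fun p : ℕ × ℕ => p.2.unpair := Computable.unpair.comp Computable.snd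
    have k2 : Computable fun p : ℕ × ℕ => p.2.unpair.1.unpair :=
      Computable.unpair.comp (Computable.fst.comp k1)
    have hp : Computable fun p : ℕ × ℕ => p.2.unpair.1.unpair.1 := Computable.fst.comp k2
    have hq : Computable fun p : ℕ × ℕ => p.2.unpair.1.unpair.2 := Computable.snd.comp k2
    have hK : Computable fun p : ℕ × ℕ => p.2.unpair.2 := Computable.snd.comp k1
    have hε : Computable fun p : ℕ × ℕ => addCode (e p.1) (dyadicCode 2 p.2.unpair.2) :=
      primrec₂_addCode.to_comp.comp (he.comp fst)
        (primrec₂_dyadicCode.to_comp.comp (Computable.const 2) hK)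
    exact computablePred_and
      (computablePred_and (computablePred_ratOfCode_lt hp (hb.comp fst))
        (computablePred_ratOfCode_lt hq (hb.comp fst)))
      (computablePred_and (computablePred_abs_sub_lt (hd.comp fst) hp hq)
        (computablePred_lt_abs_sub hε (hg.comp hp hK) (hg.comp hq hK)))
  refine (rePred_exists hQ).of_eq fun n => ?_
  rw [oscillates_iff_codedRat hf.continuous]
  constructor
  · rintro ⟨w, ⟨h1, h2⟩, h3, h4⟩
    refine ⟨w.unpair.1.unpair.1, w.unpair.1.unpair.2, by exact_mod_cast h1,
      by exact_mod_cast h2, by exact_mod_cast h3, ?_⟩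
    have e1 := happrox w.unpair.1.unpair.1 w.unpair.2
    have e2 := happrox w.unpair.1.unpair.2 w.unpair.2
    rw [ratOfCode_addCode, ratOfCode_dyadicCode, ← Rat.cast_lt (K := ℝ)] at h4
    push_cast at h4
    rw [abs_le] at e1 e2
    rw [lt_abs] at h4 ⊢
    rcases h4 with h4 | h4
    · left; linarith
    · right; linarith
  · rintro ⟨p, q, h1, h2, h3, h4⟩
    obtain ⟨K, hK⟩ := exists_pow_lt_of_lt_one
      (show 0 < (|(f (codedRat p) : ℝ) - f (codedRat q)| - ratOfCode (e n)) / 4 by linarith)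
      (show (2 : ℝ)⁻¹ < 1 by norm_num)
    refine ⟨Nat.pair (Nat.pair p q) K, ?_⟩
    simp only [Q, Nat.unpair_pair]
    refine ⟨⟨by exact_mod_cast h1, by exact_mod_cast h2⟩, by exact_mod_cast h3, ?_⟩
    have e1 := happrox p K
    have e2 := happrox q K
    rw [ratOfCode_addCode, ratOfCode_dyadicCode, ← Rat.cast_lt (K := ℝ)]
    push_cast
    rw [abs_le] at e1 e2
    rw [lt_abs]
    rcases abs_cases ((f (codedRat p) : ℝ) - f (codedRat q)) with ⟨ha, -⟩ | ⟨ha, -⟩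
    · left; linarith
    · right; linarith

/-! ### A modulus computable in the halting problem -/

/-- With an oracle for the halting problem one finds the least `n` such that `f` does not
oscillate by more than `ε` at scale `2⁻ⁿ`. -/
theorem isUniformlyContinuousIn_emptyJump_one {f : Rc → Rc} (hf : IsMarkovComputable f)
    (hright : ∀ x y : Rc, 1 ≤ (x : ℝ) → 1 ≤ (y : ℝ) → f x = f y) (huc : UniformContinuous f) :
    IsUniformlyContinuousIn (emptyJump 1) f := by
  classical
  -- Codes of nonpositive rationals are replaced by a code of `1`, which makes the search for a
  -- modulus total.
  let e : ℕ → ℕ := fun m => if ratOfCode (dyadicCode 0 0) < ratOfCode m then m else dyadicCode 1 0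
  have he : Computable e := ComputablePred.ite Computable.id (Computable.const _)
    (computablePred_ratOfCode_lt (Computable.const _) Computable.id)
  have hepos (m : ℕ) : (0 : ℝ) < ratOfCode (e m) := by
    simp only [e]
    split_ifs with h
    · rw [ratOfCode_dyadicCode] at h
      exact_mod_cast (by simpa using h : 0 < ratOfCode m)
    · simp [ratOfCode_dyadicCode]
  have hepos' {m : ℕ} (hm : 0 < ratOfCode m) : e m = m := by
    simp only [e, ratOfCode_dyadicCode]
    simp [hm]
  obtain ⟨χ, hχ, hχ0⟩ := exists_computableIn_emptyJump_one (rePred_oscillates hf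
    (he.comp (Computable.fst.comp Computable.unpair))
    (primrec₂_dyadicCode.to_comp.comp (Computable.const 1) (Computable.snd.comp Computable.unpair))
    (Computable.const (dyadicCode 2 0)))
  have hχ1 (m n : ℕ) : χ (Nat.pair m n) = 0 ↔
      ¬Oscillates f (ratOfCode (e m)) ((2 : ℝ)⁻¹ ^ n) 2 := by
    rw [hχ0]
    simp [ratOfCode_dyadicCode]
  obtain ⟨g, hg, hleast⟩ := ComputableIn.exists_least hχ fun m => by
    obtain ⟨n, hn⟩ := exists_not_oscillates huc (hepos m) 2
    exact ⟨n, (hχ1 m n).2 hn⟩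
  let t : ℕ → ℕ := fun m => dyadicCode 1 (g m + 1)
  have ht : ComputableIn {charFun (emptyJump 1)} t :=
    ComputableIn.comp_nat (g := fun n => dyadicCode 1 (n + 1))
      (primrec₂_dyadicCode.comp (Primrec.const 1) Primrec.succ).computableIn hg
  have htval (m : ℕ) : ratOfCode (t m) = (2 : ℚ)⁻¹ ^ (g m + 1) := by
    simp [t, ratOfCode_dyadicCode]
  choose code hcode using ratOfCode_surjective
  refine ⟨fun ε => ⟨ratOfCode (t (code ε)), by rw [htval]; positivity⟩, ⟨t, ht, ?_⟩, ?_⟩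
  · -- The least `n` depends only on the rational, not on its code.
    intro m hm
    have hsame : ratOfCode (e m) = ratOfCode (e (code (ratOfCode m))) := by
      rw [hepos' hm, hepos' (by rwa [hcode]), hcode]
    have hiff (n : ℕ) : χ (Nat.pair m n) = 0 ↔ χ (Nat.pair (code (ratOfCode m)) n) = 0 := by
      rw [hχ1, hχ1, hsame]
    have hgeq : g m = g (code (ratOfCode m)) := by
      refine le_antisymm (not_lt.1 fun h => ?_) (not_lt.1 fun h => ?_)
      · exact (hleast m).2 _ h ((hiff _).2 (hleast _).1)
      · exact (hleast _).2 _ h ((hiff _).1 (hleast m).1)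
    simp only [t, hgeq]
  · intro ε x y hxy
    have hn := (hχ1 _ _).1 (hleast (code ε)).1
    rw [hepos' (by rw [hcode]; exact ε.2), hcode] at hn
    have h1 : (2 : ℝ)⁻¹ ^ g (code ε) ≤ 1 := pow_le_one₀ (by norm_num) (by norm_num)
    refine abs_sub_le_of_not_oscillates hright (by exact_mod_cast ε.2.le) (by linarith) hn
      (hxy.trans_lt ?_)
    simp only [htval]
    push_cast
    have h2 : (0 : ℝ) < (2 : ℝ)⁻¹ ^ g (code ε) := by positivity
    rw [pow_succ]
    linarith

theorem IsUniformlyContinuousIn.uniformContinuous {A : Set ℕ} {f : Rc → Rc}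
    (h : IsUniformlyContinuousIn A f) : UniformContinuous f := by
  obtain ⟨θ, -, hθ⟩ := h
  rw [Metric.uniformContinuous_iff]
  intro ε hε
  obtain ⟨q, hq0, hqε⟩ := exists_rat_btwn hε
  have hq : 0 < q := by exact_mod_cast hq0
  exact ⟨((θ ⟨q, hq⟩ : ℚ) : ℝ), by exact_mod_cast (θ ⟨q, hq⟩).2,
    fun x y hxy => (hθ ⟨q, hq⟩ x y hxy.le).trans_lt hqε⟩

/-! ### The maximal extension -/

theorem maxExt_dom_of_uniformContinuous {f : Rc → Rc} (hf : UniformContinuous f) (r : ℝ) :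
    (maxExt f r).Dom := by
  unfold maxExt
  split_ifs with h
  · trivial
  · have hdense : Dense {x : ℝ | IsComputableReal x} := by
      refine Rat.isDenseEmbedding_coe_real.dense.mono ?_
      rintro _ ⟨q, rfl⟩
      obtain ⟨m, rfl⟩ := ratOfCode_surjective q
      exact (codedRat m).2
    have hne : (Filter.comap (fun x : Rc => (x : ℝ)) (nhds r)).NeBot :=
      mem_closure_iff_comap_neBot.1 (hdense r)
    have hcauchy : Cauchy (Filter.comap (fun x : Rc => (x : ℝ)) (nhds r)) :=
      (cauchy_nhds (a := r)).comap' (le_of_eq rfl) hne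
    exact cauchy_iff_exists_le_nhds.1 (hcauchy.map (uniformContinuous_subtype_val.comp hf))

theorem exists_tendsto_of_maxExt_dom {f : Rc → Rc} (hf : Continuous f) {r : ℝ}
    (h : (maxExt f r).Dom) : ∃ l : ℝ, Filter.Tendsto (fun x : Rc => (f x : ℝ))
      (Filter.comap (fun x : Rc => (x : ℝ)) (nhds r)) (nhds l) := by
  by_cases hr : IsComputableReal r
  · refine ⟨f ⟨r, hr⟩, ?_⟩
    have := (continuous_subtype_val.comp hf).tendsto ⟨r, hr⟩
    rwa [nhds_subtype_eq_comap] at this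
  · unfold maxExt at h
    rw [dif_neg hr] at h
    exact h

/-- The infimum of all `b` such that `f` oscillates by more than `ε` at every scale below `b`.
It is used only where the set of these `b` is nonempty and bounded below. -/
noncomputable def firstBadPoint (f : Rc → Rc) (ε : ℝ) : ℝ :=
  sInf {b : ℝ | ∀ n : ℕ, Oscillates f ε ((2 : ℝ)⁻¹ ^ n) b}

/-- Otherwise `f` would oscillate by at most `ε` near the point, hence, at a small enough scale,
also below some `b` to the right of it. -/
theorem not_tendsto_firstBadPoint {f : Rc → Rc} {ε : ℝ} (hε : 0 < ε) {b₀ : ℝ}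
    (h₀ : ∀ n : ℕ, Oscillates f ε ((2 : ℝ)⁻¹ ^ n) b₀)
    (hbdd : BddBelow {b : ℝ | ∀ n : ℕ, Oscillates f ε ((2 : ℝ)⁻¹ ^ n) b}) (l : ℝ) :
    ¬Filter.Tendsto (fun x : Rc => (f x : ℝ))
      (Filter.comap (fun x : Rc => (x : ℝ)) (nhds (firstBadPoint f ε))) (nhds l) := by
  intro hl
  set r := firstBadPoint f ε with hr
  obtain ⟨U, hU, hUl⟩ := Filter.mem_comap.1 (hl (Metric.ball_mem_nhds l (half_pos hε)))
  obtain ⟨η, hη, hηU⟩ := Metric.mem_nhds_iff.1 hU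
  have hclose (x y : Rc) (hx : |(x : ℝ) - r| < η) (hy : |(y : ℝ) - r| < η) :
      |(f x : ℝ) - f y| < ε := by
    have h1 : |(f x : ℝ) - l| < ε / 2 := hUl (hηU hx)
    have h2 : |(f y : ℝ) - l| < ε / 2 := hUl (hηU hy)
    rw [abs_lt] at *
    constructor <;> linarith
  obtain ⟨n, hn⟩ : ∃ n : ℕ, ¬Oscillates f ε ((2 : ℝ)⁻¹ ^ n) (r - η / 2) := by
    by_contra! hall
    have : r ≤ r - η / 2 := csInf_le hbdd hall
    linarith
  obtain ⟨b, hb, hbr⟩ := exists_lt_of_csInf_lt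
    (s := {b : ℝ | ∀ n : ℕ, Oscillates f ε ((2 : ℝ)⁻¹ ^ n) b}) ⟨b₀, h₀⟩
    (show firstBadPoint f ε < r + η by linarith)
  obtain ⟨k, hk⟩ := exists_pow_lt_of_lt_one (half_pos hη) (show (2 : ℝ)⁻¹ < 1 by norm_num)
  -- Two points below `r + η` at distance less than `η / 2` lie either both below `r - η / 2` or
  -- both within `η` of `r`.
  obtain ⟨x, y, hx, hy, hxy, hlt⟩ := hb (max n k)
  have hxyn : |(x : ℝ) - y| < (2 : ℝ)⁻¹ ^ n :=
    hxy.trans_le (pow_le_pow_of_le_one (by norm_num) (by norm_num) (le_max_left n k))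
  have hxyk : |(x : ℝ) - y| < η / 2 := (hxy.trans_le
    (pow_le_pow_of_le_one (by norm_num) (by norm_num) (le_max_right n k))).trans hk
  rw [abs_lt] at hxyk
  by_cases hcase : (x : ℝ) < r - η / 2 ∧ (y : ℝ) < r - η / 2
  · exact hn ⟨x, y, hcase.1, hcase.2, hxyn, hlt⟩
  · rw [not_and_or, not_lt, not_lt] at hcase
    refine lt_asymm hlt (hclose x y ?_ ?_) <;> rw [abs_lt] <;> rcases hcase with h | h <;>
      constructor <;> linarith

/-- The point `firstBadPoint f ε` is computable in `∅''`: whether `f` oscillates below a given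
dyadic rational at a given scale is decidable in `∅'`, hence whether it does so at every scale is
decidable in `∅''`, and the least multiple of `2⁻ⁿ` below which it does so is close to the
point. -/
theorem isDelta03Real_firstBadPoint {f : Rc → Rc} (hf : IsMarkovComputable f)
    (hleft : ∀ x y : Rc, (x : ℝ) ≤ 0 → (y : ℝ) ≤ 0 → f x = f y) {e : ℕ}
    (he : 0 < ratOfCode e) (h2 : ∀ n : ℕ, Oscillates f (ratOfCode e) ((2 : ℝ)⁻¹ ^ n) 2) :
    BddBelow {b : ℝ | ∀ n : ℕ, Oscillates f (ratOfCode e) ((2 : ℝ)⁻¹ ^ n) b} ∧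
      IsDelta03Real (firstBadPoint f (ratOfCode e)) := by
  set S := {b : ℝ | ∀ n : ℕ, Oscillates f (ratOfCode e) ((2 : ℝ)⁻¹ ^ n) b} with hS
  have hpos (b : ℝ) (hb : b ∈ S) : 0 ≤ b := by
    by_contra! hneg
    obtain ⟨x, y, hx, hy, -, hlt⟩ := hb 0
    rw [hleft x y (hx.trans hneg).le (hy.trans hneg).le, sub_self, abs_zero] at hlt
    exact lt_asymm hlt (by exact_mod_cast he)
  have hbdd : BddBelow S := ⟨0, hpos⟩
  refine ⟨hbdd, ?_⟩
  have hup {b b' : ℝ} (hb : b ∈ S) (hbb : b ≤ b') : b' ∈ S := fun n => (hb n).mono hbb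
  have h1 : Computable fun w : ℕ => w.unpair.1.unpair :=
    Computable.unpair.comp (Computable.fst.comp Computable.unpair)
  obtain ⟨χ, hχ, hχ0⟩ := exists_computableIn_emptyJump_one (rePred_oscillates hf
    (Computable.const e)
    (primrec₂_dyadicCode.to_comp.comp (Computable.const 1) (Computable.snd.comp Computable.unpair))
    (primrec₂_dyadicCode.to_comp.comp (Computable.succ.comp (Computable.snd.comp h1))
      (Computable.fst.comp h1)))
  obtain ⟨ψ, hψ, hψ0⟩ := exists_computableIn_jump_eq_zero_iff (RecursiveIn.rfind_eq_zero hχ)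
  have hψ1 (n k : ℕ) : ψ (Nat.pair n k) = 0 ↔ ((k : ℝ) + 1) * (2 : ℝ)⁻¹ ^ n ∈ S := by
    rw [hψ0]
    refine (not_congr (rfind_some_dom _)).trans ?_
    simp only [decide_eq_true_eq, hχ0, not_exists, not_not, hS, Set.mem_ofPred_eq]
    refine forall_congr' fun i => ?_
    simp [ratOfCode_dyadicCode]
  obtain ⟨g, hg, hleast⟩ := ComputableIn.exists_least hψ fun n => by
    refine ⟨2 * 2 ^ n, (hψ1 _ _).2 (hup h2 ?_)⟩
    have hpow : (2 : ℝ) ^ n * (2 : ℝ)⁻¹ ^ n = 1 := by rw [← mul_pow]; norm_num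
    have hpow' : (0 : ℝ) < (2 : ℝ)⁻¹ ^ n := by positivity
    push_cast
    nlinarith
  have hnear (n : ℕ) :
      |(g n : ℝ) * (2 : ℝ)⁻¹ ^ n - firstBadPoint f (ratOfCode e)| ≤ (2 : ℝ)⁻¹ ^ n := by
    have hupper : firstBadPoint f (ratOfCode e) ≤ ((g n : ℝ) + 1) * (2 : ℝ)⁻¹ ^ n :=
      csInf_le hbdd ((hψ1 _ _).1 (hleast n).1)
    have hlower : (g n : ℝ) * (2 : ℝ)⁻¹ ^ n ≤ firstBadPoint f (ratOfCode e) := by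
      refine le_csInf ⟨2, h2⟩ fun b hb => ?_
      rcases hgn : g n with _ | k
      · simpa using hpos b hb
      · by_contra! hlt
        have := (hleast n).2 k (by omega)
        exact this ((hψ1 _ _).2 (hup hb (by push_cast at hlt; exact hlt.le)))
    rw [abs_le]
    constructor <;> linarith [show (0 : ℝ) < (2 : ℝ)⁻¹ ^ n by positivity]
  -- The approximations of index `n` and `k ≥ n` have errors that add up, hence the shift by one.
  refine ⟨fun n => dyadicCode (g (n + 1)) (n + 1), ?_, ?_⟩
  · have hg' := ComputableIn.comp_nat hg ComputableIn.succ
    have hpair : Nat.RecursiveIn {charFun (emptyJump 2)} _ :=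
      (RecursiveIn.iff_nat.1 hg').pair (RecursiveIn.iff_nat.1 ComputableIn.succ)
    have hd : Primrec fun w : ℕ => dyadicCode w.unpair.1 w.unpair.2 :=
      primrec₂_dyadicCode.comp (Primrec.fst.comp Primrec.unpair) (Primrec.snd.comp Primrec.unpair)
    refine RecursiveIn.iff_nat.2
      ((Nat.RecursiveIn.comp (RecursiveIn.iff_nat.1 hd.computableIn) hpair).of_eq fun n => ?_)
    simp [Seq.seq]
  · have hval (n : ℕ) : ((ratOfCode (dyadicCode (g (n + 1)) (n + 1)) : ℚ) : ℝ) =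
        (g (n + 1) : ℝ) * (2 : ℝ)⁻¹ ^ (n + 1) := by
      rw [ratOfCode_dyadicCode]
      push_cast
      rfl
    have hhalf (n : ℕ) : (2 : ℝ)⁻¹ ^ n = 2 * (2 : ℝ)⁻¹ ^ (n + 1) := by ring
    refine isCauchyName_of_abs_sub_le (fun n k hnk => ?_) (fun n => ?_)
    · rw [← Rat.cast_le (K := ℝ)]
      push_cast
      rw [hval, hval, hhalf n]
      have e1 := hnear (n + 1)
      have e2 := hnear (k + 1)
      have e3 : (2 : ℝ)⁻¹ ^ (k + 1) ≤ (2 : ℝ)⁻¹ ^ (n + 1) :=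
        pow_le_pow_of_le_one (by norm_num) (by norm_num) (by omega)
      rw [abs_le] at *
      constructor <;> linarith
    · rw [hval]
      refine (hnear (n + 1)).trans ?_
      rw [hhalf n]
      linarith [show (0 : ℝ) < (2 : ℝ)⁻¹ ^ (n + 1) by positivity]

theorem uniformContinuous_of_maxExt_dom {f : Rc → Rc} (hf : IsMarkovComputable f)
    (hleft : ∀ x y : Rc, (x : ℝ) ≤ 0 → (y : ℝ) ≤ 0 → f x = f y)
    (hright : ∀ x y : Rc, 1 ≤ (x : ℝ) → 1 ≤ (y : ℝ) → f x = f y)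
    (h : ∀ r : ℝ, IsDelta03Real r → (maxExt f r).Dom) : UniformContinuous f := by
  refine uniformContinuous_of_not_oscillates hright fun e he => ?_
  by_contra! hosc
  obtain ⟨hbdd, hr⟩ := isDelta03Real_firstBadPoint hf hleft he hosc
  obtain ⟨l, hl⟩ := exists_tendsto_of_maxExt_dom hf.continuous (h _ hr)
  exact not_tendsto_firstBadPoint (by exact_mod_cast he) hosc hbdd l hl

end MarkovAnalysis

theorem mainTheorem2 (f : MarkovAnalysis.Rc → MarkovAnalysis.Rc)
    (hf : MarkovAnalysis.IsMarkovComputable f)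
    (hleft : ∀ x y : MarkovAnalysis.Rc, (x : ℝ) ≤ 0 → (y : ℝ) ≤ 0 → f x = f y)
    (hright : ∀ x y : MarkovAnalysis.Rc, 1 ≤ (x : ℝ) → 1 ≤ (y : ℝ) → f x = f y) :
    List.TFAE
      [UniformContinuous f,
        MarkovAnalysis.IsUniformlyContinuousIn (MarkovAnalysis.emptyJump 1) f,
        ∀ r : ℝ, MarkovAnalysis.IsDelta03Real r → (MarkovAnalysis.maxExt f r).Dom,
        ∀ r : ℝ, (MarkovAnalysis.maxExt f r).Dom] := by
  tfae_have 1 → 2 := MarkovAnalysis.isUniformlyContinuousIn_emptyJump_one hf hright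
  tfae_have 2 → 1 := MarkovAnalysis.IsUniformlyContinuousIn.uniformContinuous
  tfae_have 1 → 4 := MarkovAnalysis.maxExt_dom_of_uniformContinuous
  tfae_have 4 → 3 := fun h r _ => h r
  tfae_have 3 → 1 := MarkovAnalysis.uniformContinuous_of_maxExt_dom hf hleft hright
  tfae_finish
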